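/- Let $n\ge 3$ and $N=4n$. Given $x,y\in\{0,1\}^n$ such that $x_i>y_i$ for exactly one index $i\in[n]$, the 2-cycle $N\times N$ game is the following two-player game. Both players have the action set $V=[n]\times\{0,1,01,11\}$, where the first coordinate is taken modulo $n$. Let $E_A$ be the set of the following directed edges on $V$, for $i\in[n]$: from $(i,1)$ to $(i+1,0)$ if $x_{i+1}=0$ and to $(i+1,11)$ otherwise; if $x_i=0$, from $(i,0)$ to $(i+1,0)$ if $x_{i+1}=0$ and to $(i+1,01)$ otherwise; if $x_i=1$, from $(i,0)$ to $(i-1,x_{i-1})$; from $(i,01)$ and from $(i,11)$ to $(i,1)$. Let $E_B$ be the set of the following directed edges, for $i\in[n]$: from $(i,1)$ to $(i+1,0)$ if $y_{i+1}=0$ and to $(i+1,11)$ otherwise; from $(i,0)$ to $(i+1,0)$ if $y_{i+1}=0$ and to $(i+1,01)$ otherwise; from $(i,01)$ and from $(i,11)$ to $(i,1)$. The utilities are $u_A(u,v)=1$ if $(v,u)\in E_A$ and $0$ otherwise, and $u_B(u,v)=1$ if $(u,v)\in E_B$ and $0$ otherwise. For $\varepsilon\ge 0$, an $\varepsilon$-approximate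 rule correlated equilibrium of this game is a probability distribution $\mu$ on $V\times V$ such that for every $f:V\to V$, $\mathbb{E}_{(u,v)\sim\mu}[u_A(f(u),v)-u_A(u,v)]\le\varepsilon$ and $\mathbb{E}_{(u,v)\sim\mu}[u_B(u,f(v))-u_B(u,v)]\le\varepsilon$. In the communication task, $n$ and $\varepsilon$ are known to both players, player $A$ gets the table of $u_A$ and player $B$ gets the table of $u_B$. In a randomized protocol the players exchange bits, and may use common and private random coins. The protocol has error probability at most $\frac13$ if for every 2-cycle $N\times N$ game, with probability at least $\frac23$ over the coins, both players output at the end the same $\mu$, and $\mu$ is an $\varepsilon$-approximate rule correlated equilibrium of the game. Its communication complexity is the maximal number of bits exchanged, over all 2-cycle $N\times N$ games and all outcomes of the coins. **Theorem.** For every $0\le\varepsilon\le\frac{1}{24N^3}$, every randomized communication protocol for finding an $\varepsilon$-approximate rule correlated equilibrium of the 2-cycle $N\times N$ game, with error probability at most $\frac13$, has communication complexity at least $\Omega(N)$; that is, there are constants $c>0$ and $n_0$, independent of $\varepsilon$ and of the protocol, such that for all $n\ge n_0$ it is at least $cN$. -/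

import Mathlib

open MeasureTheory

/-! ### Two-player games and approximate rule correlated equilibria -/

/-- `μ` is an `ε`-approximate rule correlated equilibrium of the finite two-player game with
utility functions `uA, uB`: it is a probability distribution on pairs of actions, and no
switching rule of a player increases the expected utility of that player by more than `ε`. -/
def IsApproxRuleCorrelatedEq {U V : Type} [Fintype U] [Fintype V] (ε : ℝ)
    (uA uB : U → V → ℝ) (μ : U × V → ℝ) : Prop :=
  μ ∈ stdSimplex ℝ (U × V) ∧
  (∀ f : U → U, ∑ u, ∑ v, μ (u, v) * (uA (f u) v - uA u v) ≤ ε) ∧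
  (∀ f : V → V, ∑ u, ∑ v, μ (u, v) * (uB u (f v) - uB u v) ≤ ε)

/-! ### Communication protocols -/

/-- Deterministic two-party communication protocols (protocol trees), where player A has an input
in `X`, player B has an input in `Y`, and each of them outputs an element of `Z`.
At an inner node one player sends a bit, which depends on the own input and on the bits sent so
far; at a leaf each player computes an output from the own input and the bits sent so far. -/
inductive CommProtocol (X Y Z : Type) : Type
  | output (a : X → Z) (b : Y → Z) : CommProtocol X Y Z
  | sendA (bit : X → Bool) (next : Bool → CommProtocol X Y Z) : CommProtocol X Y Z
  | sendB (bit : Y → Bool) (next : Bool → CommProtocol X Y Z) : CommProtocol X Y Z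

namespace CommProtocol

variable {X Y Z : Type}

/-- The outputs of player A and of player B on the inputs `x` and `y`. -/
def run : CommProtocol X Y Z → X → Y → Z × Z
  | output a b, x, y => (a x, b y)
  | sendA bit next, x, y => (next (bit x)).run x y
  | sendB bit next, x, y => (next (bit y)).run x y

/-- The number of bits that are sent on the inputs `x` and `y`. -/
def bits : CommProtocol X Y Z → X → Y → ℕ
  | output _ _, _, _ => 0
  | sendA bit next, x, y => (next (bit x)).bits x y + 1
  | sendB bit next, x, y => (next (bit y)).bits x y + 1

end CommProtocol

/-- Randomized two-party protocols. There are common random coins `Common`, which both players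
see, and private random coins `CoinsA`, `CoinsB`, each seen by one player only; the three are
independent, with arbitrary probability distributions. -/
structure RandCommProtocol (X Y Z : Type) where
  Common : Type
  CoinsA : Type
  CoinsB : Type
  [mCommon : MeasurableSpace Common]
  [mA : MeasurableSpace CoinsA]
  [mB : MeasurableSpace CoinsB]
  common : ProbabilityMeasure Common
  coinsA : ProbabilityMeasure CoinsA
  coinsB : ProbabilityMeasure CoinsB
  protocol : CommProtocol (X × Common × CoinsA) (Y × Common × CoinsB) Z

namespace RandCommProtocol

attribute [instance] RandCommProtocol.mCommon RandCommProtocol.mA RandCommProtocol.mB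

variable {X Y Z : Type}

/-- The outcomes of all coins. -/
abbrev Coins (π : RandCommProtocol X Y Z) : Type := π.Common × π.CoinsA × π.CoinsB

/-- The joint distribution of all coins. -/
noncomputable def coinMeasure (π : RandCommProtocol X Y Z) : Measure π.Coins :=
  (π.common : Measure π.Common).prod
    ((π.coinsA : Measure π.CoinsA).prod (π.coinsB : Measure π.CoinsB))

/-- The outputs of player A and of player B on the inputs `x`, `y` and the coins `ω`. -/
def run (π : RandCommProtocol X Y Z) (x : X) (y : Y) (ω : π.Coins) : Z × Z :=
  π.protocol.run (x, ω.1, ω.2.1) (y, ω.1, ω.2.2)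

/-- The number of bits that are sent on the inputs `x`, `y` and the coins `ω`. -/
def bits (π : RandCommProtocol X Y Z) (x : X) (y : Y) (ω : π.Coins) : ℕ :=
  π.protocol.bits (x, ω.1, ω.2.1) (y, ω.1, ω.2.2)

/-- On every legal pair of inputs, except with probability at most `δ` over the coins, both players
output the same element `z`, and `z` is a valid answer. (No measurability is asked of the
protocol: the error event has to lie in an event of probability at most `δ`.) -/
def SolvesWithError (π : RandCommProtocol X Y Z) (legal : Set (X × Y)) (valid : X → Y → Z → Prop)
    (δ : ENNReal) : Prop :=
  ∀ x y, (x, y) ∈ legal →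
    π.coinMeasure {ω | ¬ ∃ z, π.run x y ω = (z, z) ∧ valid x y z} ≤ δ

/-- The communication complexity of `π` is at most `C`: on all legal inputs and for all outcomes
of the coins, at most `C` bits are sent. -/
def ComplexityAtMost (π : RandCommProtocol X Y Z) (legal : Set (X × Y)) (C : ℕ) : Prop :=
  ∀ x y, (x, y) ∈ legal → ∀ ω, π.bits x y ω ≤ C

end RandCommProtocol

/-! ### The 2-cycle game -/

namespace TwoCycle

/-- The vertices, `[n] × {0, 1, 01, 11}` with indices modulo `n`. The label `Sum.inl b` is the
one-bit string `b`, and the label `Sum.inr z` is the two-bit string `z1`. -/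
abbrev Vertex (n : ℕ) : Type := ZMod n × (Bool ⊕ Bool)

/-- The edges of the graph that player A builds from the string `x`. -/
inductive EdgeA {n : ℕ} (x : ZMod n → Bool) : Vertex n → Vertex n → Prop
  | one (i : ZMod n) : EdgeA x (i, Sum.inl true)
      (i + 1, if x (i + 1) = false then Sum.inl false else Sum.inr true)
  | zero (i : ZMod n) (h : x i = false) : EdgeA x (i, Sum.inl false)
      (i + 1, if x (i + 1) = false then Sum.inl false else Sum.inr false)
  | back (i : ZMod n) (h : x i = true) : EdgeA x (i, Sum.inl false) (i - 1, Sum.inl (x (i - 1)))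
  | mid (i : ZMod n) (z : Bool) : EdgeA x (i, Sum.inr z) (i, Sum.inl true)

/-- The edges of the graph that player B builds from the string `y`. -/
inductive EdgeB {n : ℕ} (y : ZMod n → Bool) : Vertex n → Vertex n → Prop
  | one (i : ZMod n) : EdgeB y (i, Sum.inl true)
      (i + 1, if y (i + 1) = false then Sum.inl false else Sum.inr true)
  | zero (i : ZMod n) : EdgeB y (i, Sum.inl false)
      (i + 1, if y (i + 1) = false then Sum.inl false else Sum.inr false)
  | mid (i : ZMod n) (z : Bool) : EdgeB y (i, Sum.inr z) (i, Sum.inl true)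

open Classical in
/-- The utility function of player A. -/
noncomputable def utilityA {n : ℕ} (x : ZMod n → Bool) (u v : Vertex n) : ℝ :=
  if EdgeA x v u then 1 else 0

open Classical in
/-- The utility function of player B. -/
noncomputable def utilityB {n : ℕ} (y : ZMod n → Bool) (u v : Vertex n) : ℝ :=
  if EdgeB y u v then 1 else 0

/-- A utility function on pairs of vertices, given as a table: the input of a player. -/
abbrev Utility (n : ℕ) : Type := Vertex n → Vertex n → ℝ

/-- The 2-cycle `N × N` games with `N = 4 * n`, as pairs of utility functions: those built from
strings `x`, `y` of length `n` with exactly one index `i` such that `x i > y i`. -/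
def games (n : ℕ) : Set (Utility n × Utility n) :=
  {g | ∃ x y : ZMod n → Bool, (∃! i, x i = true ∧ y i = false) ∧
    g = (utilityA x, utilityB y)}

end TwoCycle

/-! Put `z = ¬y`. Then `x` and `z` meet at exactly one index `s`, and an approximate equilibrium
lets one of the players find `s`. The theorem therefore reduces to the hardness of searching for the
unique common index of two strings.

Game side (`exists_heavy`, `decode_of_eq`). Each player wants to play the successor of the
opponent's action. Stability bounds every entry of a row by the mass on which the row player hits
this target, up to `ε`. Following both successor maps always advances in the cyclic order that
starts at `s`, except on entering `s` or from vertices that carry no hits. A decreasing weight then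
forces the total hit mass to be tiny, which contradicts total mass one, unless some row or column at
an entry of `s` is heavy. Heavy rows and columns lie in the range of the owner's successor map, so
their labels certify a bit of the owner's string. Hence the player whose own bit completes the test
recognizes `s`.

Communication side (`corruption_bound`, `FailBound.protocol`). A random mask gives each coordinate
to one player, which yields disjoint pairs; planting a common one yields meeting pairs. The
level-one inequality shows that a large rectangle is nearly unbiased in most coordinates, so it
contains at least `2/5` as much meeting as disjoint mass, up to an exponentially small error. Each
leaf is split by the decoded indices and by the other player's bit at the decoded index. A piece
where this bit is one contains no disjoint pair; on every other piece all meeting pairs fail.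
Summing over at most `2 ^ C` leaves gives failure at least `2/5 - o(1)` for small `C`, and this
exceeds `1/3`. -/

open scoped BigOperators

/-! ### Fourier level one on the cube, and the corruption bound -/

section Cube

variable {ι : Type} [Fintype ι] [DecidableEq ι]

theorem sum_cube_split (i : ι) (F : (ι → Bool) → ℝ) :
    2 * ∑ w, F w = ∑ w, (F (Function.update w i false) + F (Function.update w i true)) := by
  have hinv : Function.Involutive (fun w : ι → Bool => Function.update w i (!w i)) := by
    intro w
    ext j
    by_cases h : j = i
    · subst h; simp
    · simp [h]
  have h1 : ∑ w, F (Function.update w i (!w i)) = ∑ w, F w :=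
    Fintype.sum_bijective _ hinv.bijective _ _ (fun _ => rfl)
  rw [two_mul]
  nth_rw 1 [← h1]
  rw [← Finset.sum_add_distrib]
  refine Finset.sum_congr rfl fun w _ => ?_
  cases h : w i
  · have : Function.update w i false = w := by rw [← h, Function.update_eq_self]
    rw [this, Bool.not_false, add_comm]
  · have : Function.update w i true = w := by rw [← h, Function.update_eq_self]
    rw [this, Bool.not_true]

theorem expect_cube_split (i : ι) (F : (ι → Bool) → ℝ) :
    𝔼 w, F w =
      (𝔼 w, F (Function.update w i false) + 𝔼 w, F (Function.update w i true)) / 2 := by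
  have h := sum_cube_split i F
  rw [Finset.sum_add_distrib] at h
  simp only [Fintype.expect_eq_sum_div_card]
  rw [← add_div, ← h]
  ring

/-- The sign `1` for `false` and `-1` for `true`. -/
def boolSign (b : Bool) : ℝ := if b then -1 else 1

theorem expect_exp_boolSign (t : ι → ℝ) :
    𝔼 w : ι → Bool, Real.exp (∑ i, t i * boolSign (w i)) = ∏ i, Real.cosh (t i) := by
  have h := Finset.prod_univ_sum (fun _ : ι => (Finset.univ : Finset Bool))
    (fun i b => Real.exp (t i * boolSign b))
  rw [Fintype.piFinset_univ] at h
  rw [Fintype.expect_eq_sum_div_card]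
  simp only [Real.exp_sum]
  rw [← h]
  have : ((Fintype.card (ι → Bool) : ℕ) : ℝ) = ∏ _i : ι, (2 : ℝ) := by simp
  rw [this, ← Finset.prod_div_distrib]
  refine Finset.prod_congr rfl fun i _ => ?_
  rw [Real.cosh_eq]
  simp [boolSign, add_comm]

/-- The level-one inequality: a function with values in `[0, 1]` and large mean has small total
correlation with the coordinates. -/
theorem level_one_inequality (g : (ι → Bool) → ℝ) (h0 : ∀ w, 0 ≤ g w) (h1 : ∀ w, g w ≤ 1)
    (L : ℝ) :
    ∑ i, (𝔼 w, boolSign (w i) * g w) ^ 2 / (𝔼 w, g w) ≤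
      2 * (L * (𝔼 w, g w) + Real.exp (-L)) := by
  set G := 𝔼 w, g w with hG
  have hG0 : 0 ≤ G := Finset.expect_nonneg fun w _ => h0 w
  rcases hG0.eq_or_lt with hz | hpos
  · rw [← hz]; simp; positivity
  -- With these coefficients the linear form has mean exactly `s` under the density `g / G`, while
  -- its exponential moment under the uniform measure is at most `exp (s / 2)`.
  set b : ι → ℝ := fun i => (𝔼 w, boolSign (w i) * g w) / G with hb
  set s := ∑ i, b i ^ 2 with hs
  have hmean : 𝔼 w : ι → Bool, g w * (∑ i, b i * boolSign (w i)) = G * s := by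
    simp only [Finset.mul_sum]
    rw [Finset.expect_sum_comm, hs, Finset.mul_sum]
    refine Finset.sum_congr rfl fun i _ => ?_
    have : ∀ w : ι → Bool, g w * (b i * boolSign (w i)) = b i * (boolSign (w i) * g w) :=
      fun w => by ring
    simp only [this]
    rw [← Finset.mul_expect]
    have : 𝔼 w, boolSign (w i) * g w = G * b i := by
      simp only [hb]; field_simp
    rw [this]; ring
  have hlow : G * Real.exp s ≤ 𝔼 w : ι → Bool, Real.exp (∑ i, b i * boolSign (w i)) := by
    -- Jensen's inequality for the density `g / G`, by the tangent of `exp` at `s`; `g ≤ 1` then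
    -- removes the density.
    have hpt : ∀ w : ι → Bool, Real.exp s * (1 - s) * g w
        + Real.exp s * (g w * (∑ i, b i * boolSign (w i)))
        ≤ Real.exp (∑ i, b i * boolSign (w i)) := by
      intro w
      set ℓ := ∑ i, b i * boolSign (w i)
      have e1 : Real.exp s * (ℓ - s + 1) ≤ Real.exp ℓ := by
        have := Real.add_one_le_exp (ℓ - s)
        calc Real.exp s * (ℓ - s + 1) ≤ Real.exp s * Real.exp (ℓ - s) := by gcongr
          _ = Real.exp ℓ := by rw [← Real.exp_add]; ring_nf
      calc Real.exp s * (1 - s) * g w + Real.exp s * (g w * ℓ)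
          = g w * (Real.exp s * (ℓ - s + 1)) := by ring
        _ ≤ g w * Real.exp ℓ := by gcongr; exact h0 w
        _ ≤ 1 * Real.exp ℓ := by gcongr; exact h1 w
        _ = _ := one_mul _
    have := Finset.expect_le_expect (s := Finset.univ) fun w _ => hpt w
    rw [Finset.expect_add_distrib, ← Finset.mul_expect, ← Finset.mul_expect, hmean, ← hG] at this
    calc G * Real.exp s = Real.exp s * (1 - s) * G + Real.exp s * (G * s) := by ring
      _ ≤ _ := this
  have hup : 𝔼 w : ι → Bool, Real.exp (∑ i, b i * boolSign (w i)) ≤ Real.exp (s / 2) := by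
    rw [expect_exp_boolSign]
    calc ∏ i, Real.cosh (b i) ≤ ∏ i, Real.exp (b i ^ 2 / 2) :=
          Finset.prod_le_prod (fun i _ => (Real.cosh_pos _).le)
            (fun i _ => Real.cosh_le_exp_half_sq _)
      _ = Real.exp (s / 2) := by rw [← Real.exp_sum, hs, Finset.sum_div]
  have hlog : s / 2 ≤ - Real.log G := by
    have h2 := hlow.trans hup
    have h3 := Real.log_le_log (by positivity) h2
    rw [Real.log_mul hpos.ne' (Real.exp_pos _).ne', Real.log_exp, Real.log_exp] at h3
    linarith
  -- Linearizing the logarithm makes the final bound affine in `G`, so it can be averaged over masks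
  -- with one fixed `L`.
  have htan : - Real.log G ≤ L + Real.exp (-L) / G := by
    have h2 := Real.log_le_sub_one_of_pos (x := Real.exp (-L) / G) (by positivity)
    rw [Real.log_div (Real.exp_pos _).ne' hpos.ne', Real.log_exp] at h2
    linarith
  have hsum : ∑ i, (𝔼 w, boolSign (w i) * g w) ^ 2 / G = G * s := by
    rw [hs, Finset.mul_sum]
    refine Finset.sum_congr rfl fun i _ => ?_
    simp only [hb]; field_simp
  rw [hsum]
  calc G * s ≤ G * (2 * (L + Real.exp (-L) / G)) := by gcongr; linarith
    _ = _ := by field_simp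

/-- The mean of `f` on the subcube of the points below `d`. -/
noncomputable def maskMean (f : (ι → Bool) → ℝ) (d : ι → Bool) : ℝ := 𝔼 w, f (w ⊓ d)

/-- The mean of `f` on the points below `d`, with the coordinate `i` replaced by `b`. -/
noncomputable def pinMean (f : (ι → Bool) → ℝ) (i : ι) (b : Bool) (d : ι → Bool) : ℝ :=
  𝔼 w, f (Function.update (w ⊓ d) i b)

/-- The normalized squared influence of the coordinate `i` on the points below `d`. -/
noncomputable def pinGap (f : (ι → Bool) → ℝ) (i : ι) (d : ι → Bool) : ℝ :=
  (pinMean f i false d - pinMean f i true d) ^ 2 / (pinMean f i false d + pinMean f i true d)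

theorem pinMean_update (f : (ι → Bool) → ℝ) (i : ι) (b e : Bool) (d : ι → Bool) :
    pinMean f i b (Function.update d i e) = pinMean f i b d := by
  unfold pinMean
  refine Finset.expect_congr rfl fun w _ => ?_
  congr 1
  ext j
  by_cases h : j = i
  · subst h; simp
  · simp [h]

theorem pinGap_update (f : (ι → Bool) → ℝ) (i : ι) (e : Bool) (d : ι → Bool) :
    pinGap f i (Function.update d i e) = pinGap f i d := by
  simp only [pinGap, pinMean_update]

theorem compl_update {ι : Type} [DecidableEq ι] (d : ι → Bool) (i : ι) (e : Bool) :
    (Function.update d i e)ᶜ = Function.update dᶜ i (!e) := by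
  ext j
  by_cases h : j = i
  · subst h; simp
  · simp [h]

theorem update_inf_of_true {ι : Type} [DecidableEq ι] {d : ι → Bool} {i : ι} (hi : d i = true) (w : ι → Bool) (b : Bool) :
    Function.update w i b ⊓ d = Function.update (w ⊓ d) i b := by
  ext j
  by_cases h : j = i
  · subst h; simp [hi]
  · simp [h]

theorem maskMean_of_true (f : (ι → Bool) → ℝ) {i : ι} {d : ι → Bool} (hi : d i = true) :
    maskMean f d = (pinMean f i false d + pinMean f i true d) / 2 := by
  unfold maskMean pinMean
  rw [expect_cube_split i]
  simp only [update_inf_of_true hi]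

theorem maskMean_of_false (f : (ι → Bool) → ℝ) {i : ι} {d : ι → Bool} (hi : d i = false) :
    maskMean f d = pinMean f i false d := by
  unfold maskMean pinMean
  refine Finset.expect_congr rfl fun w _ => ?_
  congr 1
  ext j
  by_cases h : j = i
  · subst h; simp [hi]
  · simp [h]

theorem expect_boolSign_mul (f : (ι → Bool) → ℝ) {i : ι} {d : ι → Bool} (hi : d i = true) :
    𝔼 w : ι → Bool, boolSign (w i) * f (w ⊓ d) =
      (pinMean f i false d - pinMean f i true d) / 2 := by
  unfold pinMean
  rw [expect_cube_split i]
  simp only [update_inf_of_true hi, Function.update_self, boolSign]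
  simp [Finset.expect_neg_distrib, sub_eq_add_neg]

theorem pinMean_nonneg {f : (ι → Bool) → ℝ} (h0 : ∀ w, 0 ≤ f w) (i : ι) (b : Bool)
    (d : ι → Bool) : 0 ≤ pinMean f i b d :=
  Finset.expect_nonneg fun _ _ => h0 _

theorem maskMean_nonneg {f : (ι → Bool) → ℝ} (h0 : ∀ w, 0 ≤ f w) (d : ι → Bool) :
    0 ≤ maskMean f d :=
  Finset.expect_nonneg fun _ _ => h0 _

theorem maskMean_le_one {f : (ι → Bool) → ℝ} (h1 : ∀ w, f w ≤ 1) (d : ι → Bool) :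
    maskMean f d ≤ 1 :=
  (Finset.expect_le_expect fun w _ => h1 (w ⊓ d)).trans_eq
    (Finset.expect_const Finset.univ_nonempty 1)

/-- The level-one inequality for `w ↦ f (w ⊓ d)`, whose correlation with a free coordinate is half
the difference of the pinned means. -/
theorem sum_pinGap_le {f : (ι → Bool) → ℝ} (h0 : ∀ w, 0 ≤ f w) (h1 : ∀ w, f w ≤ 1)
    (d : ι → Bool) (L : ℝ) :
    ∑ i, (if d i = true then pinGap f i d else 0) ≤
      4 * (L * maskMean f d + Real.exp (-L)) := by
  have h := level_one_inequality (fun w => f (w ⊓ d)) (fun _ => h0 _) (fun _ => h1 _) L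
  change ∑ i, _ / maskMean f d ≤ 2 * (L * maskMean f d + _) at h
  have key : ∀ i, (if d i = true then pinGap f i d else 0) ≤
      2 * ((𝔼 w : ι → Bool, boolSign (w i) * f (w ⊓ d)) ^ 2 / maskMean f d) := by
    intro i
    split_ifs with hi
    · rw [expect_boolSign_mul f hi, maskMean_of_true f hi, pinGap]
      apply le_of_eq
      by_cases hz : pinMean f i false d + pinMean f i true d = 0
      · simp [hz]
      · field_simp
    · have := maskMean_nonneg h0 d
      positivity
  calc _ ≤ ∑ i, 2 * ((𝔼 w : ι → Bool, boolSign (w i) * f (w ⊓ d)) ^ 2 / maskMean f d) :=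
        Finset.sum_le_sum fun i _ => key i
    _ ≤ _ := by rw [← Finset.mul_sum]; linarith

/-- For small biases the product `(1 - b) * (1 - c)` suffices; large biases are paid for by the
squares. -/
theorem bias_inequality {b c : ℝ} (hb : -1 ≤ b) (hb' : b ≤ 1) (hc : -1 ≤ c) (hc' : c ≤ 1) :
    1 / 2 * (1 + (b + c) / 2) ≤
      (1 - b) * (1 - c) + 4 * (b ^ 2 * (1 + c) + c ^ 2 * (1 + b)) := by
  nlinarith [mul_nonneg (sub_nonneg.2 hb') (sub_nonneg.2 hc'),
    mul_nonneg (neg_le_iff_add_nonneg.1 hb) (neg_le_iff_add_nonneg.1 hc),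
    mul_nonneg (sub_nonneg.2 hb') (neg_le_iff_add_nonneg.1 hc),
    mul_nonneg (sub_nonneg.2 hc') (neg_le_iff_add_nonneg.1 hb),
    mul_nonneg (sq_nonneg (4 * b - 1)) (neg_le_iff_add_nonneg.1 hc),
    mul_nonneg (sq_nonneg (4 * c - 1)) (neg_le_iff_add_nonneg.1 hb)]

/-- The one-coordinate form of corruption: the left side averages the two owners of the coordinate,
and `S₁ * T₁` is the planted mass. After normalizing by `S₀ + S₁` and `T₀ + T₁` it becomes
`bias_inequality`. -/
theorem pin_inequality {S₀ S₁ T₀ T₁ : ℝ} (hS₀ : 0 ≤ S₀) (hS₁ : 0 ≤ S₁) (hT₀ : 0 ≤ T₀)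
    (hT₁ : 0 ≤ T₁) :
    1 / 4 * (S₀ * ((T₀ + T₁) / 2) + (S₀ + S₁) / 2 * T₀) ≤ S₁ * T₁ +
      (2 * ((S₀ - S₁) ^ 2 / (S₀ + S₁) * T₀) + 2 * ((T₀ - T₁) ^ 2 / (T₀ + T₁) * S₀)) := by
  rcases (add_nonneg hS₀ hS₁).eq_or_lt with hs | hs
  · have h1 : S₀ = 0 := by linarith
    have h2 : S₁ = 0 := by linarith
    simp [h1, h2]
  rcases (add_nonneg hT₀ hT₁).eq_or_lt with ht | ht
  · have h1 : T₀ = 0 := by linarith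
    have h2 : T₁ = 0 := by linarith
    simp [h1, h2]
  obtain ⟨s, hs'⟩ : ∃ s, s = S₀ + S₁ := ⟨_, rfl⟩
  obtain ⟨t, ht'⟩ : ∃ t, t = T₀ + T₁ := ⟨_, rfl⟩
  rw [← hs'] at hs ⊢
  rw [← ht'] at ht ⊢
  obtain ⟨b, hb⟩ : ∃ b, b = (S₀ - S₁) / s := ⟨_, rfl⟩
  obtain ⟨c, hc⟩ : ∃ c, c = (T₀ - T₁) / t := ⟨_, rfl⟩
  have hb1 : -1 ≤ b := by rw [hb, le_div_iff₀ hs]; linarith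
  have hb2 : b ≤ 1 := by rw [hb, div_le_iff₀ hs]; linarith
  have hc1 : -1 ≤ c := by rw [hc, le_div_iff₀ ht]; linarith
  have hc2 : c ≤ 1 := by rw [hc, div_le_iff₀ ht]; linarith
  have hbs : b * s = S₀ - S₁ := by rw [hb]; field_simp
  have hct : c * t = T₀ - T₁ := by rw [hc]; field_simp
  have e1 : S₀ = s * (1 + b) / 2 := by linarith
  have e2 : S₁ = s * (1 - b) / 2 := by linarith
  have e3 : T₀ = t * (1 + c) / 2 := by linarith
  have e4 : T₁ = t * (1 - c) / 2 := by linarith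
  rw [← hbs, ← hct, e1, e2, e3, e4]
  have h1 : (b * s) ^ 2 / s = b ^ 2 * s := by field_simp
  have h2 : (c * t) ^ 2 / t = c ^ 2 * t := by field_simp
  rw [h1, h2]
  have := mul_le_mul_of_nonneg_left (bias_inequality hb1 hb2 hc1 hc2)
    (mul_pos hs ht).le
  linarith

/-- The left integrand does not depend on `d i`, so one may condition on `d i = true` at the cost of
a factor 2; there the complementary mask already pins `g` to `false` at `i`. -/
theorem expect_pinGap_mul (f g : (ι → Bool) → ℝ) (i : ι) :
    𝔼 d, pinGap f i d * pinMean g i false dᶜ =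
      2 * 𝔼 d, (if d i = true then pinGap f i d else 0) * maskMean g dᶜ := by
  conv_rhs => rw [expect_cube_split i]
  simp only [Function.update_self, pinGap_update, if_true]
  have : ∀ d : ι → Bool, maskMean g (Function.update d i true)ᶜ = pinMean g i false dᶜ := by
    intro d
    rw [maskMean_of_false g (i := i) (by simp), compl_update, pinMean_update]
  simp only [this]
  simp only [Bool.false_eq_true, if_false, zero_mul, Finset.expect_const_zero, zero_add]
  ring

theorem expect_compl (F : (ι → Bool) → ℝ) : 𝔼 d, F dᶜ = 𝔼 d, F d :=
  Fintype.expect_bijective _ compl_involutive.bijective _ _ fun _ => rfl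

theorem sum_expect_pinGap_le {f g : (ι → Bool) → ℝ} (hf0 : ∀ w, 0 ≤ f w) (hf1 : ∀ w, f w ≤ 1)
    (hg0 : ∀ w, 0 ≤ g w) (hg1 : ∀ w, g w ≤ 1) (L : ℝ) :
    ∑ i, 𝔼 d, pinGap f i d * pinMean g i false dᶜ ≤
      8 * (L * (𝔼 d, maskMean f d * maskMean g dᶜ) + Real.exp (-L)) := by
  simp only [expect_pinGap_mul]
  rw [← Finset.mul_sum, ← Finset.expect_sum_comm]
  have : 𝔼 d, ∑ i, (if d i = true then pinGap f i d else 0) * maskMean g dᶜ ≤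
      𝔼 d, (4 * L * (maskMean f d * maskMean g dᶜ) + 4 * Real.exp (-L)) := by
    refine Finset.expect_le_expect fun d _ => ?_
    rw [← Finset.sum_mul]
    calc _ ≤ 4 * (L * maskMean f d + Real.exp (-L)) * maskMean g dᶜ :=
          mul_le_mul_of_nonneg_right (sum_pinGap_le hf0 hf1 d L) (maskMean_nonneg hg0 _)
      _ = 4 * L * (maskMean f d * maskMean g dᶜ) + 4 * Real.exp (-L) * maskMean g dᶜ := by ring
      _ ≤ 4 * L * (maskMean f d * maskMean g dᶜ) + 4 * Real.exp (-L) * 1 := by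
          have := maskMean_le_one hg1 dᶜ
          gcongr
      _ = _ := by ring
  rw [Finset.expect_add_distrib, Finset.expect_const Finset.univ_nonempty,
    ← Finset.mul_expect] at this
  linarith

/-- The corruption bound, for functions of the two coordinates instead of rectangles. -/
theorem corruption_bound {f g : (ι → Bool) → ℝ} (hf0 : ∀ w, 0 ≤ f w) (hf1 : ∀ w, f w ≤ 1)
    (hg0 : ∀ w, 0 ≤ g w) (hg1 : ∀ w, g w ≤ 1) (L : ℝ) :
    (Fintype.card ι : ℝ) / 2 * (𝔼 d, maskMean f d * maskMean g dᶜ) ≤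
      ∑ i, (𝔼 d, pinMean f i true d * pinMean g i true dᶜ) +
        32 * (L * (𝔼 d, maskMean f d * maskMean g dᶜ) + Real.exp (-L)) := by
  have hA := sum_expect_pinGap_le hf0 hf1 hg0 hg1 L
  have hB := sum_expect_pinGap_le hg0 hg1 hf0 hf1 L
  -- Complementing the mask exchanges the roles of `f` and `g`.
  have e1 : 𝔼 d, maskMean g d * maskMean f dᶜ = 𝔼 d, maskMean f d * maskMean g dᶜ := by
    rw [← expect_compl]
    refine Finset.expect_congr rfl fun d _ => ?_
    rw [compl_compl, mul_comm]
  have e2 : ∀ i, 𝔼 d, pinGap g i d * pinMean f i false dᶜ =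
      𝔼 d, pinGap g i dᶜ * pinMean f i false d := by
    intro i
    rw [← expect_compl]
    simp only [compl_compl]
  rw [e1] at hB
  simp only [e2] at hB
  have key : ∀ i, 1 / 2 * (𝔼 d, maskMean f d * maskMean g dᶜ) ≤
      (𝔼 d, pinMean f i true d * pinMean g i true dᶜ) +
      (2 * (𝔼 d, pinGap f i d * pinMean g i false dᶜ) +
        2 * (𝔼 d, pinGap g i dᶜ * pinMean f i false d)) := by
    intro i
    rw [expect_cube_split i (fun d => maskMean f d * maskMean g dᶜ)]
    have h1 : ∀ d : ι → Bool, maskMean f (Function.update d i false) = pinMean f i false d := by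
      intro d
      rw [maskMean_of_false f (i := i) (by simp), pinMean_update]
    have h2 : ∀ d : ι → Bool, maskMean f (Function.update d i true) =
        (pinMean f i false d + pinMean f i true d) / 2 := by
      intro d
      rw [maskMean_of_true f (i := i) (by simp), pinMean_update, pinMean_update]
    have h3 : ∀ d : ι → Bool, maskMean g (Function.update d i false)ᶜ =
        (pinMean g i false dᶜ + pinMean g i true dᶜ) / 2 := by
      intro d
      rw [maskMean_of_true g (i := i) (by simp), compl_update, pinMean_update, pinMean_update]
    have h4 : ∀ d : ι → Bool, maskMean g (Function.update d i true)ᶜ = pinMean g i false dᶜ := by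
      intro d
      rw [maskMean_of_false g (i := i) (by simp), compl_update, pinMean_update]
    simp only [h1, h2, h3, h4]
    rw [← Finset.expect_add_distrib, Finset.mul_expect, Finset.mul_expect,
      ← Finset.expect_add_distrib, ← Finset.expect_add_distrib, Finset.expect_div,
      Finset.mul_expect]
    refine Finset.expect_le_expect fun d _ => ?_
    have := pin_inequality (pinMean_nonneg hf0 i false d) (pinMean_nonneg hf0 i true d)
      (pinMean_nonneg hg0 i false dᶜ) (pinMean_nonneg hg0 i true dᶜ)
    rw [pinGap, pinGap]
    linarith
  have hsum := Finset.sum_le_sum (s := Finset.univ) fun i _ => key i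
  rw [Finset.sum_const, Finset.card_univ, nsmul_eq_mul, Finset.sum_add_distrib,
    Finset.sum_add_distrib, ← Finset.mul_sum, ← Finset.mul_sum] at hsum
  linarith

end Cube

/-! ### Counting frequencies -/

section Frequency

variable {Ω : Type} [Fintype Ω]

open Classical in
/-- The fraction of the elements of a finite type that satisfy a predicate. -/
noncomputable def freq (P : Ω → Prop) : ℝ := 𝔼 ω, if P ω then (1 : ℝ) else 0

theorem freq_nonneg (P : Ω → Prop) : 0 ≤ freq P :=
  Finset.expect_nonneg fun ω _ => by positivity

theorem freq_mono {P Q : Ω → Prop} (h : ∀ ω, P ω → Q ω) : freq P ≤ freq Q := by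
  classical
  refine Finset.expect_le_expect fun ω _ => ?_
  by_cases hP : P ω
  · simp [hP, h ω hP]
  · simp only [hP, if_false]; positivity

theorem freq_eq_zero {P : Ω → Prop} (h : ∀ ω, ¬ P ω) : freq P = 0 := by
  simp [freq, h]

theorem freq_eq_sum_fibers {M : Type} [Fintype M] (P : Ω → Prop) (h : Ω → M) :
    freq P = ∑ m, freq (fun ω => P ω ∧ h ω = m) := by
  classical
  unfold freq
  rw [← Finset.expect_sum_comm]
  refine Finset.expect_congr rfl fun ω _ => ?_
  by_cases hP : P ω <;> simp [hP]

end Frequency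

/-! ### Disjoint and meeting pairs -/

section Samples

variable {ι : Type} [Fintype ι] [DecidableEq ι]

/-- A disjoint pair of strings, from a mask that says which of them may be `true` where. -/
def disjointPair (ω : (ι → Bool) × (ι → Bool) × (ι → Bool)) : (ι → Bool) × (ι → Bool) :=
  (ω.2.1 ⊓ ω.1, ω.2.2 ⊓ ω.1ᶜ)

/-- A pair of strings that meet at exactly one planted index. -/
def meetingPair (ω : ι × (ι → Bool) × (ι → Bool) × (ι → Bool)) : (ι → Bool) × (ι → Bool) :=
  (Function.update (ω.2.2.1 ⊓ ω.2.1) ω.1 true, Function.update (ω.2.2.2 ⊓ ω.2.1ᶜ) ω.1 true)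

theorem disjointPair_disjoint {ι : Type} (ω : (ι → Bool) × (ι → Bool) × (ι → Bool)) (j : ι)
    (h : (disjointPair ω).1 j = true) : (disjointPair ω).2 j = false := by
  simp only [disjointPair, Pi.inf_apply, Pi.compl_apply, Bool.min_eq_and, Bool.compl_eq_bnot,
    Bool.and_eq_true] at h ⊢
  simp [h.2]

theorem meetingPair_meet_iff {ι : Type} [DecidableEq ι]
    (ω : ι × (ι → Bool) × (ι → Bool) × (ι → Bool)) (j : ι) :
    ((meetingPair ω).1 j = true ∧ (meetingPair ω).2 j = true) ↔ j = ω.1 := by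
  by_cases h : j = ω.1
  · subst h; simp [meetingPair]
  · simp only [meetingPair, Function.update_of_ne h, h, iff_false]
    simp only [Pi.inf_apply, Pi.compl_apply, Bool.min_eq_and, Bool.compl_eq_bnot,
      Bool.and_eq_true]
    cases ω.2.1 j <;> simp

open Classical in
theorem freq_disjointPair (S T : Set (ι → Bool)) :
    freq (fun ω => (disjointPair ω).1 ∈ S ∧ (disjointPair ω).2 ∈ T) =
      𝔼 d, maskMean (S.indicator 1) d * maskMean (T.indicator 1) dᶜ := by
  unfold freq
  rw [← Finset.univ_product_univ, Finset.expect_product]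
  refine Finset.expect_congr rfl fun d _ => ?_
  rw [← Finset.univ_product_univ, Finset.expect_product, maskMean, maskMean,
    Finset.expect_mul_expect]
  refine Finset.expect_congr rfl fun w _ => Finset.expect_congr rfl fun w' _ => ?_
  by_cases h1 : w ⊓ d ∈ S <;> by_cases h2 : w' ⊓ dᶜ ∈ T <;> simp [disjointPair, h1, h2]

open Classical in
theorem freq_meetingPair (S T : Set (ι → Bool)) :
    freq (fun ω => (meetingPair ω).1 ∈ S ∧ (meetingPair ω).2 ∈ T) =
      (∑ i, 𝔼 d, pinMean (S.indicator 1) i true d * pinMean (T.indicator 1) i true dᶜ) /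
        Fintype.card ι := by
  unfold freq
  rw [← Finset.univ_product_univ, Finset.expect_product, Fintype.expect_eq_sum_div_card]
  congr 1
  refine Finset.sum_congr rfl fun i _ => ?_
  rw [← Finset.univ_product_univ, Finset.expect_product]
  refine Finset.expect_congr rfl fun d _ => ?_
  rw [← Finset.univ_product_univ, Finset.expect_product, pinMean, pinMean,
    Finset.expect_mul_expect]
  refine Finset.expect_congr rfl fun w _ => Finset.expect_congr rfl fun w' _ => ?_
  by_cases h1 : Function.update (w ⊓ d) i true ∈ S <;>
    by_cases h2 : Function.update (w' ⊓ dᶜ) i true ∈ T <;> simp [meetingPair, h1, h2]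

/-- A rectangle contains about as large a fraction of the meeting pairs as of the disjoint pairs,
unless both fractions are exponentially small. -/
theorem rectangle_corruption [Nonempty ι] (S T : Set (ι → Bool)) :
    2 / 5 * freq (fun ω => (disjointPair ω).1 ∈ S ∧ (disjointPair ω).2 ∈ T) ≤
      freq (fun ω => (meetingPair ω).1 ∈ S ∧ (meetingPair ω).2 ∈ T) +
        32 * Real.exp (-((Fintype.card ι : ℝ) / 320)) := by
  classical
  have hind0 : ∀ (S : Set (ι → Bool)) (w : ι → Bool), (0 : ℝ) ≤ S.indicator 1 w :=
    fun S w => Set.indicator_nonneg (fun _ _ => zero_le_one) w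
  have hind1 : ∀ (S : Set (ι → Bool)) (w : ι → Bool), (S.indicator 1 w : ℝ) ≤ 1 :=
    fun S w => Set.indicator_le_self' (fun _ _ => zero_le_one) w
  -- This `L` gives `32 * L = n / 10`, which leaves the coefficient `1/2 - 1/10 = 2/5`.
  have h := corruption_bound (hind0 S) (hind1 S) (hind0 T) (hind1 T)
    ((Fintype.card ι : ℝ) / 320)
  rw [freq_disjointPair, freq_meetingPair]
  set D := 𝔼 d, maskMean (S.indicator 1) d * maskMean (T.indicator 1) dᶜ
  set E := ∑ i, 𝔼 d, pinMean (S.indicator 1) i true d * pinMean (T.indicator 1) i true dᶜ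
  have hn : (1 : ℝ) ≤ Fintype.card ι := by exact_mod_cast Fintype.card_pos
  set n := (Fintype.card ι : ℝ)
  have hexp := Real.exp_pos (-(n / 320))
  have h2 : n * (2 / 5 * D) ≤ n * (E / n + 32 * Real.exp (-(n / 320))) := by
    have e1 : n * (E / n + 32 * Real.exp (-(n / 320))) = E + n * (32 * Real.exp (-(n / 320))) := by
      field_simp
    rw [e1]
    nlinarith
  exact le_of_mul_le_mul_left h2 (by linarith)

end Samples

/-! ### Failure of short protocols -/

section Protocols

variable {ι : Type} [Fintype ι] [DecidableEq ι]

/-- The fraction of the disjoint pairs in a rectangle is at most, up to `e`, a multiple of the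
fraction of the meeting pairs in the rectangle that have the property `F`. -/
def FailBound (F : ι × (ι → Bool) × (ι → Bool) × (ι → Bool) → Prop) (S T : Set (ι → Bool))
    (e : ℝ) : Prop :=
  2 / 5 * freq (fun ω => (disjointPair ω).1 ∈ S ∧ (disjointPair ω).2 ∈ T) ≤
    freq (fun ω => ((meetingPair ω).1 ∈ S ∧ (meetingPair ω).2 ∈ T) ∧ F ω) + e

variable {F : ι × (ι → Bool) × (ι → Bool) × (ι → Bool) → Prop} {S T : Set (ι → Bool)} {e : ℝ}

theorem FailBound.mono {G : ι × (ι → Bool) × (ι → Bool) × (ι → Bool) → Prop} {e' : ℝ}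
    (h : FailBound F S T e) (he : e ≤ e')
    (hFG : ∀ ω, (meetingPair ω).1 ∈ S → (meetingPair ω).2 ∈ T → F ω → G ω) :
    FailBound G S T e' := by
  refine le_trans h (add_le_add (freq_mono ?_) he)
  rintro ω ⟨⟨h1, h2⟩, h3⟩
  exact ⟨⟨h1, h2⟩, hFG ω h1 h2 h3⟩

/-- Both frequencies are additive over the fibers of `h`, so only the errors accumulate. -/
theorem FailBound.splitA {M : Type} [Fintype M] (h : (ι → Bool) → M)
    (hm : ∀ m, FailBound F (S ∩ {x | h x = m}) T e) :
    FailBound F S T (Fintype.card M * e) := by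
  unfold FailBound
  rw [freq_eq_sum_fibers _ (fun ω => h (disjointPair ω).1),
    freq_eq_sum_fibers _ (fun ω => h (meetingPair ω).1), Finset.mul_sum]
  refine (Finset.sum_le_sum fun m _ => ?_).trans_eq
    (show ∑ m, (freq (fun ω => (((meetingPair ω).1 ∈ S ∧ (meetingPair ω).2 ∈ T) ∧ F ω) ∧
      h (meetingPair ω).1 = m) + e) = _ by simp [Finset.sum_add_distrib])
  refine le_trans (le_of_eq ?_) ((hm m).trans (le_of_eq ?_)) <;> congr 2 <;> ext ω <;>
    simp only [Set.mem_inter_iff, Set.mem_ofPred_eq] <;> tauto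

theorem FailBound.splitB {M : Type} [Fintype M] (h : (ι → Bool) → M)
    (hm : ∀ m, FailBound F S (T ∩ {x | h x = m}) e) :
    FailBound F S T (Fintype.card M * e) := by
  unfold FailBound
  rw [freq_eq_sum_fibers _ (fun ω => h (disjointPair ω).2),
    freq_eq_sum_fibers _ (fun ω => h (meetingPair ω).2), Finset.mul_sum]
  refine (Finset.sum_le_sum fun m _ => ?_).trans_eq
    (show ∑ m, (freq (fun ω => (((meetingPair ω).1 ∈ S ∧ (meetingPair ω).2 ∈ T) ∧ F ω) ∧
      h (meetingPair ω).2 = m) + e) = _ by simp [Finset.sum_add_distrib])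
  refine le_trans (le_of_eq ?_) ((hm m).trans (le_of_eq ?_)) <;> congr 2 <;> ext ω <;>
    simp only [Set.mem_inter_iff, Set.mem_ofPred_eq] <;> tauto

theorem FailBound.of_forall [Nonempty ι]
    (hF : ∀ ω, (meetingPair ω).1 ∈ S → (meetingPair ω).2 ∈ T → F ω) :
    FailBound F S T (32 * Real.exp (-((Fintype.card ι : ℝ) / 320))) := by
  refine (rectangle_corruption S T).trans ?_
  gcongr
  exact freq_mono fun ω h => ⟨h, hF ω h.1 h.2⟩

theorem FailBound.of_no_disjoint (he : 0 ≤ e)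
    (h : ∀ x ∈ S, ∀ z ∈ T, ∃ j, x j = true ∧ z j = true) : FailBound F S T e := by
  unfold FailBound
  rw [freq_eq_zero, mul_zero]
  · exact add_nonneg (freq_nonneg _) he
  · rintro ω ⟨h1, h2⟩
    obtain ⟨j, hx, hz⟩ := h _ h1 _ h2
    rw [disjointPair_disjoint ω j hx] at hz
    exact Bool.noConfusion hz

/-- If the players of a meeting pair can decode the planted index from good outputs, then the
outputs of a fixed leaf are not good for many meeting pairs. -/
theorem FailBound.output [Nonempty ι] (decA decB : (ι → Bool) → Option ι)
    (hA : ∀ x i, decA x = some i → x i = true) (hB : ∀ z i, decB z = some i → z i = true)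
    (hF : ∀ ω, ¬ F ω → decA (meetingPair ω).1 = some ω.1 ∨
      (decA (meetingPair ω).1 = none ∧ decB (meetingPair ω).2 = some ω.1)) :
    FailBound F S T (2 * ((Fintype.card ι : ℝ) + 1) ^ 2 *
      (32 * Real.exp (-((Fintype.card ι : ℝ) / 320)))) := by
  set δ := 32 * Real.exp (-((Fintype.card ι : ℝ) / 320)) with hδ
  have hδ0 : 0 ≤ δ := by positivity
  set n := (Fintype.card ι : ℝ)
  have hn0 : 0 ≤ n := Nat.cast_nonneg _
  have hcard : ((Fintype.card (Option ι) : ℕ) : ℝ) = n + 1 := by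
    rw [Fintype.card_option]; push_cast; rfl
  have hbool : ((Fintype.card Bool : ℕ) : ℝ) = 2 := by simp
  have h1 : FailBound F S T ((Fintype.card (Option ι) : ℕ) * (2 * (n + 1) * δ)) := by
    refine FailBound.splitA decA fun m => ?_
    cases m with
    | some i =>
      have : FailBound F (S ∩ {x | decA x = some i}) T ((Fintype.card Bool : ℕ) * δ) := by
        -- The other player's bit at the decoded index separates disjoint pairs (bit zero) from
        -- correct decodings (bit one).
        refine FailBound.splitB (fun z => z i) fun b => ?_
        cases b with
        | true =>
          refine FailBound.of_no_disjoint hδ0 ?_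
          rintro x ⟨_, hx⟩ z ⟨_, hz⟩
          exact ⟨i, hA x i hx, hz⟩
        | false =>
          refine FailBound.of_forall ?_
          rintro ω ⟨_, hx⟩ ⟨_, hz⟩
          by_contra hω
          have hx' : decA (meetingPair ω).1 = some i := hx
          have hz' : (meetingPair ω).2 i = false := hz
          rcases hF ω hω with h | h
          · rw [hx'] at h
            have := ((meetingPair_meet_iff ω i).2 (Option.some.inj h)).2
            rw [hz'] at this
            exact Bool.noConfusion this
          · rw [hx'] at h
            exact Option.some_ne_none _ h.1
      refine this.mono ?_ fun ω _ _ h => h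
      rw [hbool]
      nlinarith
    | none =>
      have : FailBound F (S ∩ {x | decA x = none}) T
          ((Fintype.card (Option ι) : ℕ) * (2 * δ)) := by
        refine FailBound.splitB decB fun m => ?_
        cases m with
        | some j =>
          rw [← hbool]
          refine FailBound.splitA (fun x => x j) fun b => ?_
          cases b with
          | true =>
            refine FailBound.of_no_disjoint hδ0 ?_
            rintro x ⟨_, hx⟩ z ⟨_, hz⟩
            exact ⟨j, hx, hB z j hz⟩
          | false =>
            refine FailBound.of_forall ?_
            rintro ω ⟨⟨_, hx⟩, hxj⟩ ⟨_, hz⟩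
            by_contra hω
            have hx' : decA (meetingPair ω).1 = none := hx
            have hxj' : (meetingPair ω).1 j = false := hxj
            have hz' : decB (meetingPair ω).2 = some j := hz
            rcases hF ω hω with h | h
            · rw [hx'] at h
              exact Option.some_ne_none _ h.symm
            · rw [hz'] at h
              have := ((meetingPair_meet_iff ω j).2 (Option.some.inj h.2)).1
              rw [hxj'] at this
              exact Bool.noConfusion this
        | none =>
          refine (FailBound.of_forall ?_).mono (by linarith) fun ω _ _ h => h
          rintro ω ⟨_, hx⟩ ⟨_, hz⟩
          by_contra hω
          have hx' : decA (meetingPair ω).1 = none := hx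
          have hz' : decB (meetingPair ω).2 = none := hz
          rcases hF ω hω with h | h
          · rw [hx'] at h
            exact Option.some_ne_none _ h.symm
          · rw [hz'] at h
            exact Option.some_ne_none _ h.2.symm
      refine this.mono (le_of_eq ?_) fun ω _ _ h => h
      rw [hcard]
      ring
  refine h1.mono (le_of_eq ?_) fun ω _ _ h => h
  rw [hcard]
  ring

/-- A deterministic protocol in which few bits are sent fails on many meeting pairs, if the
players can decode the planted index from outputs that are good. -/
theorem FailBound.protocol [Nonempty ι] {X Y Z : Type} (eA : (ι → Bool) → X)
    (eB : (ι → Bool) → Y) (decA decB : (ι → Bool) → Z → Option ι)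
    (hA : ∀ x a i, decA x a = some i → x i = true) (hB : ∀ z b i, decB z b = some i → z i = true)
    (good : ι × (ι → Bool) × (ι → Bool) × (ι → Bool) → Z × Z → Prop)
    (hgood : ∀ ω p, good ω p → decA (meetingPair ω).1 p.1 = some ω.1 ∨
      (decA (meetingPair ω).1 p.1 = none ∧ decB (meetingPair ω).2 p.2 = some ω.1))
    (P : CommProtocol X Y Z) (k : ℕ) (S T : Set (ι → Bool)) :
    FailBound (fun ω => ¬ (P.bits (eA (meetingPair ω).1) (eB (meetingPair ω).2) ≤ k ∧
        good ω (P.run (eA (meetingPair ω).1) (eB (meetingPair ω).2)))) S T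
      (2 ^ k * (2 * ((Fintype.card ι : ℝ) + 1) ^ 2 *
        (32 * Real.exp (-((Fintype.card ι : ℝ) / 320))))) := by
  set δ := 32 * Real.exp (-((Fintype.card ι : ℝ) / 320)) with hδ
  have hδ0 : 0 ≤ δ := by positivity
  set n := (Fintype.card ι : ℝ) with hn
  have hn0 : 0 ≤ n := Nat.cast_nonneg _
  have hsq : 1 ≤ 2 * (n + 1) ^ 2 := by nlinarith
  have hbool : ((Fintype.card Bool : ℕ) : ℝ) = 2 := by simp
  induction P generalizing k S T with
  | output a b =>
    have := FailBound.output (S := S) (T := T)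
      (F := fun ω => ¬ good ω (a (eA (meetingPair ω).1), b (eB (meetingPair ω).2)))
      (fun x => decA x (a (eA x))) (fun z => decB z (b (eB z)))
      (fun x i => hA x _ i) (fun z i => hB z _ i) (fun ω h => hgood ω _ (not_not.1 h))
    refine this.mono ?_ ?_
    · rw [← hδ, ← hn]
      exact le_mul_of_one_le_left (by positivity) (one_le_pow₀ (by norm_num))
    · rintro ω _ _ h ⟨_, h'⟩
      exact h h'
  | sendA bit next ih =>
    cases k with
    -- Exceeding the bit budget counts as failure, so here every meeting pair fails and corruption
    -- applies directly.
    | zero =>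
      refine (FailBound.of_forall ?_).mono ?_ fun ω _ _ h => h
      · rintro ω _ _ ⟨h, _⟩
        simp [CommProtocol.bits] at h
      · rw [pow_zero, one_mul]
        exact le_mul_of_one_le_left hδ0 hsq
    | succ k =>
      rw [pow_succ', mul_assoc, ← hbool]
      refine FailBound.splitA (fun x => bit (eA x)) fun m => ?_
      refine (ih m k (S ∩ {x | bit (eA x) = m}) T).mono le_rfl ?_
      rintro ω ⟨_, hb⟩ _ h ⟨h1, h2⟩
      have hb' : bit (eA (meetingPair ω).1) = m := hb
      simp only [CommProtocol.bits, CommProtocol.run, hb'] at h1 h2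
      exact h ⟨by omega, h2⟩
  | sendB bit next ih =>
    cases k with
    | zero =>
      refine (FailBound.of_forall ?_).mono ?_ fun ω _ _ h => h
      · rintro ω _ _ ⟨h, _⟩
        simp [CommProtocol.bits] at h
      · rw [pow_zero, one_mul]
        exact le_mul_of_one_le_left hδ0 hsq
    | succ k =>
      rw [pow_succ', mul_assoc, ← hbool]
      refine FailBound.splitB (fun x => bit (eB x)) fun m => ?_
      refine (ih m k S (T ∩ {x | bit (eB x) = m})).mono le_rfl ?_
      rintro ω _ ⟨_, hb⟩ h ⟨h1, h2⟩
      have hb' : bit (eB (meetingPair ω).2) = m := hb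
      simp only [CommProtocol.bits, CommProtocol.run, hb'] at h1 h2
      exact h ⟨by omega, h2⟩

end Protocols

/-! ### Approximate equilibria of pursuit games -/

section Pursuit

variable {V : Type} [Fintype V] [DecidableEq V]

/-- The total weight of a row. -/
def rowSum (μ : V × V → ℝ) (u : V) : ℝ := ∑ v, μ (u, v)

/-- The total weight of a column. -/
def colSum (μ : V × V → ℝ) (v : V) : ℝ := ∑ u, μ (u, v)

/-- The weight in the row `u` of the columns that `a` maps to `u`. -/
def rowHit (a : V → V) (μ : V × V → ℝ) (u : V) : ℝ := ∑ v, if a v = u then μ (u, v) else 0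

theorem rowHit_nonneg {a : V → V} {μ : V × V → ℝ} (hμ : ∀ p, 0 ≤ μ p) (u : V) :
    0 ≤ rowHit a μ u :=
  Finset.sum_nonneg fun v _ => by split_ifs <;> simp [hμ]

theorem rowHit_of_notMem_range {a : V → V} (μ : V × V → ℝ) {u : V} (h : u ∉ Set.range a) :
    rowHit a μ u = 0 :=
  Finset.sum_eq_zero fun v _ => if_neg fun e => h ⟨v, e⟩

/-- No switching rule of the row player, who wants to play the image under `a` of the action of
the column player, gains more than `ε`. -/
def RowStable (ε : ℝ) (a : V → V) (μ : V × V → ℝ) : Prop :=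
  ∀ f : V → V, ∑ u, ∑ v, μ (u, v) *
    ((if a v = f u then 1 else 0) - (if a v = u then 1 else 0)) ≤ ε

variable {a b : V → V} {μ : V × V → ℝ} {ε : ℝ}

theorem RowStable.switch_le (h : RowStable ε a μ) (u u' : V) :
    ∑ v, (if a v = u' then μ (u, v) else 0) ≤ rowHit a μ u + ε := by
  have h1 := h (Function.update id u u')
  rw [Finset.sum_eq_single u] at h1
  · simp only [Function.update_self, mul_sub, mul_ite, mul_one, mul_zero,
      Finset.sum_sub_distrib] at h1
    unfold rowHit
    linarith
  · intro w _ hw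
    simp [Function.update_of_ne hw]
  · simp

/-- The mass of the row splits by the image of the column under `a`, and each part is what some
single switch would hit. -/
theorem RowStable.rowSum_le (h : RowStable ε a μ) (u : V) :
    rowSum μ u ≤ Fintype.card V * (rowHit a μ u + ε) := by
  have : rowSum μ u = ∑ u', ∑ v, (if a v = u' then μ (u, v) else 0) := by
    rw [Finset.sum_comm]
    simp [rowSum]
  rw [this, ← nsmul_eq_mul, ← Finset.card_univ, ← Finset.sum_const]
  exact Finset.sum_le_sum fun u' _ => h.switch_le u u'

/-- A row outside the range has no hits, so stability keeps it light. This turns heaviness into a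
certificate. -/
theorem RowStable.mem_range (h : RowStable ε a μ) {u : V}
    (hu : Fintype.card V * ε < rowSum μ u) : u ∈ Set.range a := by
  by_contra hn
  have := h.rowSum_le u
  rw [rowHit_of_notMem_range μ hn, zero_add] at this
  linarith

theorem rowHit_le_rowSum (hμ : ∀ p, 0 ≤ μ p) (u : V) : rowHit a μ u ≤ rowSum μ u :=
  Finset.sum_le_sum fun v _ => by split_ifs <;> simp [hμ]

theorem RowStable.apply_le (h : RowStable ε a μ) (hμ : ∀ p, 0 ≤ μ p) (u v : V) :
    μ (u, v) ≤ rowHit a μ u + ε := by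
  refine le_trans ?_ (h.switch_le u (a v))
  have := Finset.single_le_sum (f := fun w => if a w = a v then μ (u, w) else 0)
    (fun w _ => by split_ifs <;> simp [hμ]) (Finset.mem_univ v)
  simpa using this

/-- The weighted sum of the hits of the row player outside `K` is controlled by the hits of the
column player, if moving along `a` lowers the weight. -/
theorem sum_weight_rowHit_le (hε : 0 ≤ ε) (hμ : ∀ p, 0 ≤ μ p)
    (hb : RowStable ε b (μ ∘ Prod.swap)) {c : V → ℝ} {T : ℝ} (hc1 : ∀ v, 1 ≤ c v)
    (hcT : ∀ v, c v ≤ T) {K : Finset V}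
    (ha : ∀ v, a v ∈ K ∨ v ∉ Set.range b ∨ c (a v) + 1 ≤ c v) :
    ∑ u, (if u ∈ K then 0 else c u * rowHit a μ u) ≤
      ∑ v, (c v - 1) * rowHit b (μ ∘ Prod.swap) v + Fintype.card V * (T * ε) := by
  have hμ' : ∀ p, 0 ≤ (μ ∘ Prod.swap) p := fun p => hμ _
  -- Regroup the hits by column: the column `v` contributes only at the row `a v`.
  have e1 : ∑ u, (if u ∈ K then 0 else c u * rowHit a μ u) =
      ∑ v, (if a v ∈ K then 0 else c (a v) * μ (a v, v)) := by
    have : ∀ u, (if u ∈ K then 0 else c u * rowHit a μ u) =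
        ∑ v, if a v = u then (if a v ∈ K then 0 else c (a v) * μ (a v, v)) else 0 := by
      intro u
      by_cases hu : u ∈ K
      · rw [if_pos hu]
        refine (Finset.sum_eq_zero fun v _ => ?_).symm
        split_ifs with h1 h2
        · rfl
        · exact absurd (h1 ▸ hu) h2
        · rfl
      · rw [if_neg hu, rowHit, Finset.mul_sum]
        refine Finset.sum_congr rfl fun v _ => ?_
        split_ifs with h1 h2
        · exact absurd (h1 ▸ h2) hu
        · rw [h1]
        · rw [mul_zero]
    simp only [this]
    rw [Finset.sum_comm]
    simp
  rw [e1, ← nsmul_eq_mul, ← Finset.card_univ, ← Finset.sum_const, ← Finset.sum_add_distrib]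
  refine Finset.sum_le_sum fun v _ => ?_
  have hg := rowHit_nonneg (a := b) hμ' v
  have h1 : μ (a v, v) ≤ rowHit b (μ ∘ Prod.swap) v + ε := hb.apply_le hμ' v (a v)
  have hcv := hc1 v
  have hca := hc1 (a v)
  have hTε : c (a v) * ε ≤ T * ε := mul_le_mul_of_nonneg_right (hcT _) hε
  have h0 : 0 ≤ (c v - 1) * rowHit b (μ ∘ Prod.swap) v := mul_nonneg (by linarith) hg
  have hT0 : 0 ≤ c (a v) * ε := mul_nonneg (by linarith) hε
  split_ifs with hK
  · linarith
  · have h2 : c (a v) * μ (a v, v) ≤ c (a v) * (rowHit b (μ ∘ Prod.swap) v + ε) :=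
      mul_le_mul_of_nonneg_left h1 (by linarith)
    rcases ha v with h | h | h
    · exact absurd h hK
    -- A column outside the range of `b` has no hits, so only the `ε` term remains.
    · rw [rowHit_of_notMem_range _ h] at h2 ⊢
      linarith
    · have : c (a v) * rowHit b (μ ∘ Prod.swap) v ≤ (c v - 1) * rowHit b (μ ∘ Prod.swap) v :=
        mul_le_mul_of_nonneg_right (by linarith) hg
      linarith

theorem sum_weight_eq (c : V → ℝ) (K : Finset V) (g : V → ℝ) :
    ∑ u, c u * g u = ∑ u, (if u ∈ K then 0 else c u * g u) + ∑ u ∈ K, c u * g u := by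
  have : ∑ u ∈ K, c u * g u = ∑ u, (if u ∈ K then c u * g u else 0) := by
    rw [Finset.sum_ite_mem, Finset.univ_inter]
  rw [this, ← Finset.sum_add_distrib]
  refine Finset.sum_congr rfl fun u _ => ?_
  split_ifs <;> simp

/-- If moving along `a` and `b` lowers a bounded weight, except for moves into a small set, then
an approximate equilibrium puts weight on a row or a column in the small set. -/
theorem exists_heavy (hε : 0 ≤ ε) (hμ : ∀ p, 0 ≤ μ p) (hsum : ∑ p, μ p = 1)
    (ha : RowStable ε a μ) (hb : RowStable ε b (μ ∘ Prod.swap)) {c : V → ℝ} {T : ℝ}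
    (hc1 : ∀ v, 1 ≤ c v) (hcT : ∀ v, c v ≤ T) {K : Finset V} (hK : K.card ≤ 3)
    (hca : ∀ v, a v ∈ K ∨ v ∉ Set.range b ∨ c (a v) + 1 ≤ c v)
    (hcb : ∀ u, b u ∈ K ∨ u ∉ Set.range a ∨ c (b u) + 1 ≤ c u)
    (hT : Fintype.card V * (8 * (Fintype.card V * (T * ε)) + Fintype.card V * ε) < 1) :
    ∃ u ∈ K, Fintype.card V * ε < rowSum μ u ∨ Fintype.card V * ε < colSum μ u := by
  by_contra! hsmall
  set N := (Fintype.card V : ℝ) with hN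
  have hN0 : 0 ≤ N := Nat.cast_nonneg _
  have hμ' : ∀ p, 0 ≤ (μ ∘ Prod.swap) p := fun p => hμ _
  have hT0 : 0 ≤ T := by
    rcases isEmpty_or_nonempty V with hV | ⟨⟨v⟩⟩
    · simp at hsum
    · linarith [hc1 v, hcT v]
  set gA := rowHit a μ with hgA
  set gB := rowHit b (μ ∘ Prod.swap) with hgB
  have hA := sum_weight_rowHit_le hε hμ hb hc1 hcT hca
  have hB := sum_weight_rowHit_le (a := b) (b := a) (μ := μ ∘ Prod.swap) hε hμ' ha hc1 hcT hcb
  have hswap : (μ ∘ Prod.swap) ∘ Prod.swap = μ := by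
    ext p; simp
  rw [hswap] at hB
  rw [← hgA, ← hgB, ← hN] at hA hB
  have hKbound : ∀ g : V → ℝ, (∀ u ∈ K, g u ≤ N * ε) → (∀ u, 0 ≤ g u) →
      ∑ u ∈ K, c u * g u ≤ 3 * (T * (N * ε)) := by
    intro g hg hg0
    have hpos : 0 ≤ T * (N * ε) := by positivity
    calc ∑ u ∈ K, c u * g u ≤ ∑ u ∈ K, T * (N * ε) :=
          Finset.sum_le_sum fun u hu => mul_le_mul (hcT u) (hg u hu) (hg0 u) hT0
      _ = K.card * (T * (N * ε)) := by rw [Finset.sum_const, nsmul_eq_mul]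
      _ ≤ 3 * (T * (N * ε)) := mul_le_mul_of_nonneg_right (by exact_mod_cast hK) hpos
  have hKA := hKbound gA (fun u hu => (rowHit_le_rowSum hμ u).trans (hsmall u hu).1)
    (rowHit_nonneg hμ)
  have hKB := hKbound gB (fun u hu => (rowHit_le_rowSum hμ' u).trans (hsmall u hu).2)
    (rowHit_nonneg hμ')
  have hwA := sum_weight_eq c K gA
  have hwB := sum_weight_eq c K gB
  simp only [sub_mul, one_mul, Finset.sum_sub_distrib] at hA hB
  have hgB0 : 0 ≤ ∑ v, gB v := Finset.sum_nonneg fun v _ => rowHit_nonneg hμ' v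
  -- Adding the two weighted bounds cancels the weights and leaves the total hits. Each player
  -- contributes one error from stability and three from `K`, hence 8.
  have htot : ∑ u, gA u ≤ 8 * (N * (T * ε)) := by
    have : T * (N * ε) = N * (T * ε) := by ring
    rw [this] at hKA hKB
    linarith
  have hone : (1 : ℝ) ≤ N * (∑ u, gA u + N * ε) := by
    rw [← hsum, Fintype.sum_prod_type]
    calc ∑ u, ∑ v, μ (u, v) ≤ ∑ u, N * (gA u + ε) :=
          Finset.sum_le_sum fun u _ => ha.rowSum_le u
      _ = _ := by
        rw [← Finset.mul_sum, Finset.sum_add_distrib, Finset.sum_const, Finset.card_univ,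
          nsmul_eq_mul]
  have : N * (∑ u, gA u + N * ε) ≤ N * (8 * (N * (T * ε)) + N * ε) := by gcongr
  linarith

end Pursuit

/-! ### The 2-cycle game: successors, rank and decoding -/

namespace TwoCycle

variable {n : ℕ}

/-- The unique out-neighbour of a vertex in the graph of player A. -/
def succA (x : ZMod n → Bool) : Vertex n → Vertex n
  | (i, Sum.inl true) => (i + 1, if x (i + 1) = false then Sum.inl false else Sum.inr true)
  | (i, Sum.inl false) =>
      if x i = false then (i + 1, if x (i + 1) = false then Sum.inl false else Sum.inr false)
      else (i - 1, Sum.inl (x (i - 1)))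
  | (i, Sum.inr _) => (i, Sum.inl true)

/-- The unique out-neighbour of a vertex in the graph of player B. -/
def succB (y : ZMod n → Bool) : Vertex n → Vertex n
  | (i, Sum.inl true) => (i + 1, if y (i + 1) = false then Sum.inl false else Sum.inr true)
  | (i, Sum.inl false) => (i + 1, if y (i + 1) = false then Sum.inl false else Sum.inr false)
  | (i, Sum.inr _) => (i, Sum.inl true)

theorem edgeA_iff (x : ZMod n → Bool) (v u : Vertex n) : EdgeA x v u ↔ succA x v = u := by
  constructor
  · intro h
    cases h with
    | one i => rfl
    | zero i h => simp only [succA, if_pos h]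
    | back i h => simp [succA, h]
    | mid i z => rfl
  · rintro rfl
    obtain ⟨i, (_ | _) | z⟩ := v
    · by_cases h : x i = false
      · simp only [succA, if_pos h]
        exact EdgeA.zero i h
      · simp only [succA, if_neg h]
        exact EdgeA.back i (by simpa using h)
    · exact EdgeA.one i
    · exact EdgeA.mid i z

theorem edgeB_iff (y : ZMod n → Bool) (v u : Vertex n) : EdgeB y v u ↔ succB y v = u := by
  constructor
  · intro h
    cases h <;> rfl
  · rintro rfl
    obtain ⟨i, (_ | _) | z⟩ := v
    · exact EdgeB.zero i
    · exact EdgeB.one i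
    · exact EdgeB.mid i z

/-- Every edge into such a vertex chooses its label by the bit at the target index. The same reason
gives the next three lemmas. -/
theorem eq_false_of_mem_range_succA {x : ZMod n → Bool} {i : ZMod n}
    (h : (i, Sum.inl false) ∈ Set.range (succA x)) : x i = false := by
  obtain ⟨⟨j, (_ | _) | z⟩, hv⟩ := h <;> simp only [succA] at hv
  · split_ifs at hv with h1 h2 <;> simp only [Prod.mk.injEq, Sum.inl.injEq, reduceCtorEq,
      and_false, and_true] at hv
    · rwa [← hv]
    · rw [← hv.1]; exact hv.2
  · split_ifs at hv with h1 <;> simp only [Prod.mk.injEq, reduceCtorEq, and_false,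
      and_true] at hv
    rwa [← hv]
  · simp at hv

theorem eq_true_of_mem_range_succA {x : ZMod n → Bool} {i : ZMod n} {z : Bool}
    (h : (i, Sum.inr z) ∈ Set.range (succA x)) : x i = true := by
  obtain ⟨⟨j, (_ | _) | z'⟩, hv⟩ := h <;> simp only [succA] at hv
  · split_ifs at hv with h1 h2 <;> simp only [Prod.mk.injEq, reduceCtorEq, and_false] at hv
    rw [← hv.1]; simpa using h2
  · split_ifs at hv with h1 <;> simp only [Prod.mk.injEq, reduceCtorEq, and_false] at hv
    rw [← hv.1]; simpa using h1
  · simp at hv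

theorem eq_false_of_mem_range_succB {y : ZMod n → Bool} {i : ZMod n}
    (h : (i, Sum.inl false) ∈ Set.range (succB y)) : y i = false := by
  obtain ⟨⟨j, (_ | _) | z⟩, hv⟩ := h <;> simp only [succB] at hv
  · split_ifs at hv with h1 <;> simp only [Prod.mk.injEq, reduceCtorEq, and_false,
      and_true] at hv
    rwa [← hv]
  · split_ifs at hv with h1 <;> simp only [Prod.mk.injEq, reduceCtorEq, and_false,
      and_true] at hv
    rwa [← hv]
  · simp at hv

theorem eq_true_of_mem_range_succB {y : ZMod n → Bool} {i : ZMod n} {z : Bool}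
    (h : (i, Sum.inr z) ∈ Set.range (succB y)) : y i = true := by
  obtain ⟨⟨j, (_ | _) | z'⟩, hv⟩ := h <;> simp only [succB] at hv
  · split_ifs at hv with h1 <;> simp only [Prod.mk.injEq, reduceCtorEq, and_false] at hv
    rw [← hv.1]; simpa using h1
  · split_ifs at hv with h1 <;> simp only [Prod.mk.injEq, reduceCtorEq, and_false] at hv
    rw [← hv.1]; simpa using h1
  · simp at hv

theorem rowStable_of_eq [NeZero n] {x y : ZMod n → Bool} {ε : ℝ} {μ : Vertex n × Vertex n → ℝ}
    (h : IsApproxRuleCorrelatedEq ε (utilityA x) (utilityB y) μ) :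
    RowStable ε (succA x) μ := by
  intro f
  refine le_trans (le_of_eq ?_) (h.2.1 f)
  simp only [utilityA, edgeA_iff]

theorem colStable_of_eq [NeZero n] {x y : ZMod n → Bool} {ε : ℝ} {μ : Vertex n × Vertex n → ℝ}
    (h : IsApproxRuleCorrelatedEq ε (utilityA x) (utilityB y) μ) :
    RowStable ε (succB y) (μ ∘ Prod.swap) := by
  intro f
  refine le_trans (le_of_eq ?_) (h.2.2 f)
  simp only [utilityB, edgeB_iff]
  exact Finset.sum_comm

/-- The order in which the vertices are visited from the index `s` on. -/
def rank (s : ZMod n) : Vertex n → ℕ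
  | (i, Sum.inl true) => 2 * (i - s).val + 1
  | (i, Sum.inl false) => 2 * (i - s).val
  | (i, Sum.inr _) => 2 * (i - s).val

theorem rank_lt [NeZero n] (s : ZMod n) (v : Vertex n) : rank s v < 2 * n := by
  obtain ⟨i, (_ | _) | z⟩ := v <;> simp only [rank] <;> have := ZMod.val_lt (i - s) <;> omega

theorem val_succ_sub [NeZero n] {i s : ZMod n} (h : i + 1 ≠ s) :
    (i + 1 - s).val = (i - s).val + 1 := by
  have hlt := ZMod.val_lt (i - s)
  have hcast : (((i - s).val + 1 : ℕ) : ZMod n) = i + 1 - s := by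
    push_cast
    rw [ZMod.natCast_zmod_val]
    ring
  rcases (Nat.succ_le_of_lt hlt).lt_or_eq with h1 | h1
  · rw [← hcast, ZMod.val_cast_of_lt h1]
  · exfalso
    rw [← Nat.succ_eq_add_one, h1, ZMod.natCast_self] at hcast
    exact h (sub_eq_zero.1 hcast.symm)

/-- The vertices at which a path enters the index `s` from the index before. -/
def entry (s : ZMod n) : Finset (Vertex n) :=
  {(s, Sum.inl false), (s, Sum.inr false), (s, Sum.inr true)}

theorem succB_entry_or_rank_lt [NeZero n] (y : ZMod n → Bool) (s : ZMod n) (u : Vertex n) :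
    succB y u ∈ entry s ∨ rank s u < rank s (succB y u) := by
  obtain ⟨i, (_ | _) | z⟩ := u
  · by_cases h : i + 1 = s
    · left; simp only [succB, entry, h]; split_ifs <;> simp
    · right
      simp only [succB]
      split_ifs <;> simp only [rank, val_succ_sub h] <;> omega
  · by_cases h : i + 1 = s
    · left; simp only [succB, entry, h]; split_ifs <;> simp
    · right
      simp only [succB]
      split_ifs <;> simp only [rank, val_succ_sub h] <;> omega
  · right; simp [succB, rank]

/-- A backward move starts at `(i, 0)` with `x i = true`. If B can also reach this vertex, then `y i
= false` and `i = s`, where the rank is 0 and stepping back jumps to the far end of the order. -/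
theorem succA_entry_or_rank_lt [NeZero n] (hn : 2 ≤ n) {x y : ZMod n → Bool} {s : ZMod n}
    (hs : ∀ j, x j = true → y j = false → j = s) (v : Vertex n) :
    succA x v ∈ entry s ∨ v ∉ Set.range (succB y) ∨ rank s v < rank s (succA x v) := by
  obtain ⟨i, (_ | _) | z⟩ := v
  · by_cases hx : x i = false
    · by_cases h : i + 1 = s
      · left; simp only [succA, entry, h, hx]; split_ifs <;> simp
      · right; right
        simp only [succA, hx, if_true]
        split_ifs <;> simp only [rank, val_succ_sub h] <;> omega
    · right
      by_contra! hcon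
      have hi := hs i (by simpa using hx) (eq_false_of_mem_range_succB hcon.1)
      subst hi
      have hpos : 0 < (i - 1 - i).val := by
        rw [Nat.pos_iff_ne_zero, Ne, ZMod.val_eq_zero]
        intro h0
        have : (1 : ZMod n) = 0 := by
          have : i - 1 - i = -1 := by ring
          rw [this] at h0
          simpa using h0
        have : Fact (1 < n) := ⟨hn⟩
        exact one_ne_zero ‹(1 : ZMod n) = 0›
      have h0 : rank i (i, Sum.inl false) = 0 := by simp [rank]
      have h1 : 0 < rank i (i - 1, Sum.inl (x (i - 1))) := by
        cases x (i - 1) <;> simp only [rank] <;> omega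
      have h2 := hcon.2
      simp only [succA, if_neg hx, h0] at h2
      omega
  · by_cases h : i + 1 = s
    · left; simp only [succA, entry, h]; split_ifs <;> simp
    · right; right
      simp only [succA]
      split_ifs <;> simp only [rank, val_succ_sub h] <;> omega
  · right; right; simp [succA, rank]

theorem card_vertex [NeZero n] : (Fintype.card (Vertex n) : ℝ) = 4 * n := by
  simp [Vertex, ZMod.card]
  ring

/-- Every approximate equilibrium is heavy on a row or on a column that reveals the index at which
the strings of the players meet. -/
theorem exists_heavy_of_eq [NeZero n] (hn : 2 ≤ n) {x y : ZMod n → Bool} {s : ZMod n}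
    (hxs : x s = true) (hys : y s = false) (hs : ∀ j, x j = true → y j = false → j = s)
    {ε : ℝ} (hε : 0 ≤ ε) (hε' : ε ≤ 1 / (24 * (4 * (n : ℝ)) ^ 3))
    {μ : Vertex n × Vertex n → ℝ}
    (h : IsApproxRuleCorrelatedEq ε (utilityA x) (utilityB y) μ) :
    4 * n * ε < colSum μ (s, Sum.inl false) ∨ ∃ z, 4 * n * ε < rowSum μ (s, Sum.inr z) := by
  have hA := rowStable_of_eq h
  have hB := colStable_of_eq h
  have hn1 : (1 : ℝ) ≤ n := by exact_mod_cast (by omega : 1 ≤ n)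
  -- Reversing the rank gives a weight between 1 and `2 * n` that drops by at least 1 along each
  -- advancing move.
  obtain ⟨u, huK, hu⟩ := exists_heavy (c := fun v => 2 * (n : ℝ) - rank s v) (T := 2 * n)
    (K := entry s) hε h.1.1 h.1.2 hA hB
    (fun v => by
      have : ((rank s v + 1 : ℕ) : ℝ) ≤ ((2 * n : ℕ) : ℝ) := by exact_mod_cast rank_lt s v
      push_cast at this
      linarith)
    (fun v => by
      have : (0 : ℝ) ≤ rank s v := Nat.cast_nonneg _
      linarith)
    Finset.card_le_three
    (fun v => by
      rcases succA_entry_or_rank_lt hn hs v with h | h | h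
      · exact Or.inl h
      · exact Or.inr (Or.inl h)
      · refine Or.inr (Or.inr ?_)
        have : ((rank s v + 1 : ℕ) : ℝ) ≤ rank s (succA x v) := by exact_mod_cast h
        push_cast at this
        linarith)
    (fun v => by
      rcases succB_entry_or_rank_lt y s v with h | h
      · exact Or.inl h
      · refine Or.inr (Or.inr ?_)
        have : ((rank s v + 1 : ℕ) : ℝ) ≤ rank s (succB y v) := by exact_mod_cast h
        push_cast at this
        linarith)
    (by
      rw [card_vertex]
      rw [le_div_iff₀ (by positivity)] at hε'
      have h2 : (n : ℝ) ^ 2 ≤ n ^ 3 := pow_le_pow_right₀ hn1 (by norm_num)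
      have h3 : (n : ℝ) ^ 2 * ε ≤ n ^ 3 * ε := mul_le_mul_of_nonneg_right h2 hε
      nlinarith)
  rw [card_vertex] at hu
  rcases hu with hu | hu
  · right
    have hr := hA.mem_range (u := u) (by rwa [card_vertex])
    -- Since `x s = true`, player A never enters `(s, 0)`, so a heavy row must carry a two-bit
    -- label.
    simp only [entry, Finset.mem_insert, Finset.mem_singleton] at huK
    rcases huK with rfl | rfl | rfl
    · rw [eq_false_of_mem_range_succA hr] at hxs
      exact Bool.noConfusion hxs
    · exact ⟨_, hu⟩
    · exact ⟨_, hu⟩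
  · left
    have hr := hB.mem_range (u := u) (by rw [card_vertex]; exact hu)
    simp only [entry, Finset.mem_insert, Finset.mem_singleton] at huK
    rcases huK with rfl | rfl | rfl
    · exact hu
    · rw [eq_true_of_mem_range_succB hr] at hys
      exact Bool.noConfusion hys
    · rw [eq_true_of_mem_range_succB hr] at hys
      exact Bool.noConfusion hys

open Classical in
/-- The index that player A reads off a distribution. -/
noncomputable def decodeA [NeZero n] (ε : ℝ) (x : ZMod n → Bool)
    (μ : Vertex n × Vertex n → ℝ) : Option (ZMod n) :=
  if h : ∃ i, x i = true ∧ 4 * n * ε < colSum μ (i, Sum.inl false) then some h.choose else none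

open Classical in
/-- The index that player B, whose string is the complement of `z`, reads off a distribution. -/
noncomputable def decodeB [NeZero n] (ε : ℝ) (z : ZMod n → Bool)
    (μ : Vertex n × Vertex n → ℝ) : Option (ZMod n) :=
  if h : ∃ i, z i = true ∧ ∃ c, 4 * n * ε < rowSum μ (i, Sum.inr c) then some h.choose else none

theorem eq_true_of_decodeA [NeZero n] {ε : ℝ} {x : ZMod n → Bool} {μ : Vertex n × Vertex n → ℝ}
    {i : ZMod n} (h : decodeA ε x μ = some i) : x i = true := by
  unfold decodeA at h
  split_ifs at h with h1
  rw [← Option.some.inj h]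
  exact h1.choose_spec.1

theorem eq_true_of_decodeB [NeZero n] {ε : ℝ} {z : ZMod n → Bool} {μ : Vertex n × Vertex n → ℝ}
    {i : ZMod n} (h : decodeB ε z μ = some i) : z i = true := by
  unfold decodeB at h
  split_ifs at h with h1
  rw [← Option.some.inj h]
  exact h1.choose_spec.1

/-- From an approximate equilibrium one of the players can decode the meeting index. -/
theorem decode_of_eq [NeZero n] (hn : 2 ≤ n) {x z : ZMod n → Bool} {s : ZMod n}
    (hs : ∀ j, (x j = true ∧ z j = true) ↔ j = s)
    {ε : ℝ} (hε : 0 ≤ ε) (hε' : ε ≤ 1 / (24 * (4 * (n : ℝ)) ^ 3))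
    {μ : Vertex n × Vertex n → ℝ}
    (h : IsApproxRuleCorrelatedEq ε (utilityA x) (utilityB fun j => !z j) μ) :
    decodeA ε x μ = some s ∨ (decodeA ε x μ = none ∧ decodeB ε z μ = some s) := by
  have hss := (hs s).2 rfl
  have hA := rowStable_of_eq h
  have hB := colStable_of_eq h
  have heavy := exists_heavy_of_eq hn hss.1 (by simp [hss.2])
    (fun j h1 h2 => (hs j).1 ⟨h1, by simpa using h2⟩) hε hε' h
  by_cases hex : ∃ i, x i = true ∧ 4 * n * ε < colSum μ (i, Sum.inl false)
  · left
    rw [decodeA, dif_pos hex]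
    have hr := hB.mem_range (u := (hex.choose, Sum.inl false))
      (by rw [card_vertex]; exact hex.choose_spec.2)
    have := eq_false_of_mem_range_succB hr
    rw [(hs _).1 ⟨hex.choose_spec.1, by simpa using this⟩]
  · right
    refine ⟨dif_neg hex, ?_⟩
    rcases heavy with h1 | h1
    · exact absurd ⟨s, hss.1, h1⟩ hex
    have hex' : ∃ i, z i = true ∧ ∃ c, 4 * n * ε < rowSum μ (i, Sum.inr c) := ⟨s, hss.2, h1⟩
    rw [decodeB, dif_pos hex']
    obtain ⟨c, hc⟩ := hex'.choose_spec.2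
    have hr := hA.mem_range (by rw [card_vertex]; exact hc)
    rw [(hs _).1 ⟨eq_true_of_mem_range_succA hr, hex'.choose_spec.1⟩]

end TwoCycle

/-! ### Fixing the coins, and the final estimate -/

/-- If events indexed by a finite type all have small probability, then some outcome lies in a
small fraction of them. -/
theorem exists_freq_mem_le {Ω Γ : Type} [Fintype Ω] [Nonempty Ω] [MeasurableSpace Γ]
    (P : Measure Γ) [IsProbabilityMeasure P] (E : Ω → Set Γ) {δ : NNReal}
    (hE : ∀ ω, P (E ω) ≤ δ) : ∃ γ, freq (fun ω => γ ∈ E ω) ≤ δ := by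
  classical
  -- The events need not be measurable, so the average runs over their measurable hulls.
  set F : Γ → ENNReal := fun γ => ∑ ω, (toMeasurable P (E ω)).indicator 1 γ with hF
  have hmeas : Measurable F := Finset.measurable_sum _ fun ω _ =>
    measurable_one.indicator (measurableSet_toMeasurable _ _)
  have hint : ∫⁻ γ, F γ ∂P ≤ Fintype.card Ω * δ := by
    rw [hF, lintegral_finsetSum _ fun ω _ =>
      measurable_one.indicator (measurableSet_toMeasurable _ _)]
    calc ∑ ω, ∫⁻ γ, (toMeasurable P (E ω)).indicator 1 γ ∂P ≤ ∑ _ω : Ω, (δ : ENNReal) := by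
          refine Finset.sum_le_sum fun ω _ => ?_
          rw [lintegral_indicator_one (measurableSet_toMeasurable _ _), measure_toMeasurable]
          exact hE ω
      _ = _ := by simp
  obtain ⟨γ, hγ⟩ := exists_le_lintegral hmeas.aemeasurable (μ := P)
  refine ⟨γ, ?_⟩
  have h1 : (∑ ω, if γ ∈ E ω then (1 : ENNReal) else 0) ≤ Fintype.card Ω * δ := by
    refine le_trans (Finset.sum_le_sum fun ω _ => ?_) (hγ.trans hint)
    split_ifs with h
    · rw [Set.indicator_of_mem (subset_toMeasurable _ _ h)]; rfl
    · exact zero_le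
  have h2 : (∑ ω, if γ ∈ E ω then (1 : NNReal) else 0) ≤ Fintype.card Ω * δ := by
    rw [← ENNReal.coe_le_coe]
    push_cast
    refine le_trans (le_of_eq (Finset.sum_congr rfl fun ω _ => ?_)) h1
    split_ifs <;> simp
  have h3 : (∑ ω, if γ ∈ E ω then (1 : ℝ) else 0) ≤ Fintype.card Ω * δ := by
    have := NNReal.coe_le_coe.2 h2
    push_cast [apply_ite] at this
    exact this
  have hc : (0 : ℝ) < Fintype.card Ω := by exact_mod_cast Fintype.card_pos
  rw [freq, Fintype.expect_eq_sum_div_card, div_le_iff₀ hc, mul_comm]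
  exact h3

instance RandCommProtocol.isProbabilityMeasure_coinMeasure {X Y Z : Type}
    (π : RandCommProtocol X Y Z) : IsProbabilityMeasure π.coinMeasure := by
  unfold RandCommProtocol.coinMeasure
  infer_instance

/-- The factor `2 ^ C` uses up at most half of the exponent `n / 320`; the cubic Taylor term of the
other half beats the quadratic factor. The bound `1/15` is the gap `2/5 - 1/3`. -/
theorem two_pow_mul_exp_small {n C : ℕ} (hn : 10 ^ 13 ≤ n) (hC : (C : ℝ) < n / 640) :
    2 ^ C * (2 * ((n : ℝ) + 1) ^ 2 * (32 * Real.exp (-((n : ℝ) / 320)))) < 1 / 15 := by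
  have hn' : (10 : ℝ) ^ 13 ≤ n := by exact_mod_cast hn
  set t := (n : ℝ) with ht
  have h2 : (2 : ℝ) ^ C ≤ Real.exp (t / 640) := by
    calc (2 : ℝ) ^ C ≤ (Real.exp 1) ^ C := by
          gcongr
          linarith [Real.add_one_le_exp (1 : ℝ)]
      _ = Real.exp C := by rw [← Real.exp_nat_mul, mul_one]
      _ ≤ _ := Real.exp_le_exp.2 hC.le
  have h3 : (t / 640) ^ 3 / 6 ≤ Real.exp (t / 640) := by
    have := Real.pow_div_factorial_le_exp (t / 640) (by positivity) 3
    simpa [Nat.factorial] using this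
  have he : Real.exp (t / 640) * Real.exp (-(t / 320)) = (Real.exp (t / 640))⁻¹ := by
    rw [← Real.exp_add, ← Real.exp_neg]
    ring_nf
  calc 2 ^ C * (2 * (t + 1) ^ 2 * (32 * Real.exp (-(t / 320))))
      ≤ Real.exp (t / 640) * (2 * (t + 1) ^ 2 * (32 * Real.exp (-(t / 320)))) := by gcongr
    _ = 64 * (t + 1) ^ 2 * (Real.exp (t / 640) * Real.exp (-(t / 320))) := by ring
    _ = 64 * (t + 1) ^ 2 / Real.exp (t / 640) := by
      rw [he, ← div_eq_mul_inv]
    _ < 1 / 15 := by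
      rw [div_lt_iff₀ (Real.exp_pos _)]
      have h4 : (t + 1) ^ 2 ≤ 4 * t ^ 2 := by nlinarith
      have h5 : 10 ^ 13 * t ^ 2 ≤ t ^ 3 := by
        rw [pow_succ t 2, mul_comm]
        gcongr
      have h6 : 0 < t ^ 2 := by positivity
      have h7 : (t / 640) ^ 3 / 6 = t ^ 3 / 1572864000 := by ring
      linarith

/-- There are constants `c > 0` and `n₀` such that, with `N = 4 * n` and `n ≥ n₀`, every randomized
protocol that finds an `ε`-approximate rule correlated equilibrium of the 2-cycle `N × N` game with
error probability at most `1 / 3`, where `ε ≤ 1 / (24 * N ^ 3)`, sends at least `c * N` bits. -/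
theorem theorem2 :
    ∃ c : ℝ, 0 < c ∧ ∃ n₀ : ℕ, ∀ (n : ℕ) [NeZero n], 3 ≤ n → n₀ ≤ n →
      ∀ ε : ℝ, 0 ≤ ε → ε ≤ 1 / (24 * (4 * (n : ℝ)) ^ 3) →
      ∀ π : RandCommProtocol (TwoCycle.Utility n) (TwoCycle.Utility n)
          (TwoCycle.Vertex n × TwoCycle.Vertex n → ℝ),
        π.SolvesWithError (TwoCycle.games n)
          (fun uA uB μ => IsApproxRuleCorrelatedEq ε uA uB μ) (1 / 3) →
        ∀ C : ℕ, π.ComplexityAtMost (TwoCycle.games n) C → c * (4 * (n : ℝ)) ≤ (C : ℝ) := by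
  -- Here `2560 = 4 * 640`, so `c * N = n / 640`.
  refine ⟨1 / 2560, by norm_num, 10 ^ 13, ?_⟩
  intro n _ hn3 hn ε hε hε' π hπ C hC
  by_contra! hlt
  have hsmall := two_pow_mul_exp_small hn (C := C) (by linarith)
  set tA : (ZMod n → Bool) → TwoCycle.Utility n := fun x => TwoCycle.utilityA x
  set tB : (ZMod n → Bool) → TwoCycle.Utility n := fun z => TwoCycle.utilityB fun j => !z j
  have hlegal : ∀ ω : ZMod n × (ZMod n → Bool) × (ZMod n → Bool) × (ZMod n → Bool),
      (tA (meetingPair ω).1, tB (meetingPair ω).2) ∈ TwoCycle.games n := by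
    intro ω
    refine ⟨(meetingPair ω).1, fun j => !(meetingPair ω).2 j, ⟨ω.1, ?_, ?_⟩, rfl⟩
    · simpa using (meetingPair_meet_iff ω ω.1).2 rfl
    · intro j hj
      exact (meetingPair_meet_iff ω j).1 (by simpa using hj)
  -- Fix coins, private ones included, for which at most a third of the meeting pairs fail.
  obtain ⟨γ, hγ⟩ := exists_freq_mem_le π.coinMeasure
    (fun ω : ZMod n × (ZMod n → Bool) × (ZMod n → Bool) × (ZMod n → Bool) =>
      {γ | ¬ ∃ μ, π.run (tA (meetingPair ω).1) (tB (meetingPair ω).2) γ = (μ, μ) ∧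
        IsApproxRuleCorrelatedEq ε (tA (meetingPair ω).1) (tB (meetingPair ω).2) μ})
    (δ := 1 / 3) (fun ω => by simpa using hπ _ _ (hlegal ω))
  have hfail := FailBound.protocol
    (fun x => (tA x, γ.1, γ.2.1)) (fun z => (tB z, γ.1, γ.2.2))
    (TwoCycle.decodeA ε) (TwoCycle.decodeB ε)
    (fun x a i => TwoCycle.eq_true_of_decodeA) (fun z b i => TwoCycle.eq_true_of_decodeB)
    (fun ω p => ∃ μ, p = (μ, μ) ∧
      IsApproxRuleCorrelatedEq ε (tA (meetingPair ω).1) (tB (meetingPair ω).2) μ)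
    (by
      rintro ω p ⟨μ, rfl, hμ⟩
      exact TwoCycle.decode_of_eq (by omega) (meetingPair_meet_iff ω) hε hε' hμ)
    π.protocol C Set.univ Set.univ
  have hone : freq (fun ω : (ZMod n → Bool) × (ZMod n → Bool) × (ZMod n → Bool) =>
      (disjointPair ω).1 ∈ Set.univ ∧ (disjointPair ω).2 ∈ Set.univ) = 1 := by
    simp [freq]
  unfold FailBound at hfail
  rw [hone, ZMod.card] at hfail
  have hle : freq (fun ω : ZMod n × (ZMod n → Bool) × (ZMod n → Bool) × (ZMod n → Bool) =>
      ((meetingPair ω).1 ∈ Set.univ ∧ (meetingPair ω).2 ∈ Set.univ) ∧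
        ¬ (π.protocol.bits (tA (meetingPair ω).1, γ.1, γ.2.1)
            (tB (meetingPair ω).2, γ.1, γ.2.2) ≤ C ∧
          ∃ μ, π.protocol.run (tA (meetingPair ω).1, γ.1, γ.2.1)
            (tB (meetingPair ω).2, γ.1, γ.2.2) = (μ, μ) ∧
          IsApproxRuleCorrelatedEq ε (tA (meetingPair ω).1) (tB (meetingPair ω).2) μ)) ≤ 1 / 3 := by
    refine (freq_mono ?_).trans (hγ.trans_eq (by norm_num))
    rintro ω ⟨_, h⟩ hgood
    exact h ⟨hC _ _ (hlegal ω) γ, hgood⟩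
  linarith
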